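/- For $s=1,2,\dots$ put $$K_s=\frac{s!}{\pi}\max_{\alpha\in\mathbb R}\int_{-\pi/2}^{\pi/2}\big|\cos\big(\alpha+(s+1)\varphi\big)\big|\cos^{s-1}\varphi\,d\varphi .$$ Let $\Omega$ be a domain (a non-empty connected open set) in $\mathbb C$, and let $\mathfrak R(\Omega)$ be the set of holomorphic functions $f$ in $\Omega$ with $\sup_\Omega|\Re f|\le 1$. Assume that a point $\zeta\in\partial\Omega$ is touched by an interior disk $D$, that is, $D\subset\Omega$ is an open disk of positive radius with $\zeta\in\partial D$. Then, for every $s=1,2,\dots$, $$\limsup_{z\to\zeta}\ \sup_{f\in\mathfrak R(\Omega)}|z-\zeta|^s\,|f^{(s)}(z)|\le K_s,$$ where $z$ runs over the points, other than $\zeta$, of the radius of $D$ directed from the center of $D$ to $\zeta$. The constant $K_s$ cannot be diminished: for every $s\ge 1$ and every real $C<K_s$ there are a domain $\Omega$, a point $\zeta\in\partial\Omega$ and an interior disk $D$ touching $\partial\Omega$ at $\zeta$ for which this upper limit is greater than $C$. -/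

import Mathlib

open scoped Topology ENNReal

namespace RealPart

noncomputable section

/-- `ℜ(Ω)`: the holomorphic functions `f` in `Ω` with `sup_Ω |Re f| ≤ 1`. -/
def realPartClass (Ω : Set ℂ) : Set (ℂ → ℂ) :=
  {f | DifferentiableOn ℂ f Ω ∧ ∀ z ∈ Ω, |(f z).re| ≤ 1}

/-- `Ω` is a domain in `ℂ` and its boundary point `ζ` is touched by the interior disk `D` with
center `c` and radius `R`: `D ⊆ Ω` and `ζ` lies on the circle bounding `D`. -/
structure TouchedByDisk (Ω : Set ℂ) (ζ c : ℂ) (R : ℝ) : Prop where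
  isOpen : IsOpen Ω
  isConnected : IsConnected Ω
  mem_frontier : ζ ∈ frontier Ω
  radius_pos : 0 < R
  disk_subset : Metric.ball c R ⊆ Ω
  mem_circle : ζ ∈ Metric.sphere c R

/-- `∫_{-π/2}^{π/2} |cos (α + (s + 1) φ)| cos ^ (s - 1) φ dφ`. -/
def cosIntegral (s : ℕ) (α : ℝ) : ℝ :=
  ∫ φ in (-(Real.pi / 2))..(Real.pi / 2),
    |Real.cos (α + ((s : ℝ) + 1) * φ)| * Real.cos φ ^ (s - 1)

/-- `K_s = (s! / π) max_α ∫_{-π/2}^{π/2} |cos (α + (s + 1) φ)| cos ^ (s - 1) φ dφ`, for `s ≥ 1`. -/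
def K (s : ℕ) : ℝ :=
  (Nat.factorial s : ℝ) / Real.pi * ⨆ α : ℝ, cosIntegral s α

/-- The supremum in `K` is a maximum. -/
theorem isGreatest_cosIntegral (s : ℕ) :
    IsGreatest (Set.range (cosIntegral s)) (⨆ α : ℝ, cosIntegral s α) := by
  have hc : Continuous (cosIntegral s) := by
    unfold cosIntegral
    apply intervalIntegral.continuous_parametric_intervalIntegral_of_continuous'
    fun_prop
  have hp : Function.Periodic (cosIntegral s) (2 * Real.pi) := by
    intro α
    unfold cosIntegral
    congr 1
    ext φ
    rw [show α + 2 * Real.pi + ((s : ℝ) + 1) * φ = α + ((s : ℝ) + 1) * φ + 2 * Real.pi by ring,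
      Real.cos_add_two_pi]
  have hk : IsCompact (Set.range (cosIntegral s)) :=
    hp.compact_of_continuous Real.two_pi_pos.ne' hc
  exact hk.isGreatest_sSup (Set.range_nonempty _)

/-- `limsup_{z → ζ} sup_{f ∈ ℜ(Ω)} |z - ζ| ^ s |f^{(s)}(z)|`, an extended nonnegative real, where
`z` is a point of the open segment from `c` to `ζ`. -/
def radialLimsup (s : ℕ) (Ω : Set ℂ) (ζ c : ℂ) : ℝ≥0∞ :=
  Filter.limsup
    (fun z : ℂ => ⨆ f ∈ realPartClass Ω, ENNReal.ofReal (‖z - ζ‖ ^ s * ‖iteratedDeriv s f z‖))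
    (𝓝[openSegment ℝ c ζ] ζ)

end

end RealPart

/-!
For `s = n + 1`, the argument rests on one identity, Bol's lemma
(`iteratedDeriv_affine_pow_mul_comp`). Let `D` be the disk of center `c` and radius `R`, and let
`φ w = c + (ζ - c) * (r + w) / (1 + r * w)`, which maps the unit disk onto `D` and `0` to the point
of the radius towards `ζ` at distance `(1 - r) * R` from `ζ`. For `f` holomorphic in `D` and
`g = f ∘ φ`, the `(n + 1)`-st derivative of `f` at `φ 0`, multiplied by
`((ζ - c) * (1 - r ^ 2)) ^ (n + 1)`, is the `(n + 1)`-st derivative at `0` of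
`(1 + r * w) ^ n * g w`. Only Taylor coefficients of `g` of positive order enter, since the first
factor has degree `n`. These are determined by `Re g` on a circle about `0`, so the derivative
equals `2 * (n + 1)!` times the average over that circle of `Re g` against the bounded kernel
`(1 + r * z) ^ n * z⁻¹ ^ (n + 1)` (`iteratedDeriv_affine_pow_mul_eq_circleAverage`). As `r` and the
radius of the circle tend to `1`, the kernel tends to `(1 + z) ^ n * z⁻¹ ^ (n + 1)`, which for
`z = exp (2 * θ * I)` is `2 ^ n * cos θ ^ n * exp (-(n + 2) * θ * I)`. The `L¹` norms of the real
parts of its rotations are therefore, up to a constant factor, the integrals in the definition of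
`K` (`circleAverage_abs_re_kernel`), and pairing with a density bounded by one gives the upper
estimate (`radialLimsup_le`).

The estimate is sharp in the unit disk. Let `g` be the Schwarz integral of the sign of the real part
of an optimally rotated limit kernel (`exists_extremal`). Composing `g` with the automorphism of the
disk that moves `r` to `0` gives a competitor for each `r`, and Bol's lemma shows that the weighted
derivatives of these competitors at `r` have a limit that is at least `K (n + 1)`
(`K_le_radialLimsup_unit`).
-/

namespace RealPart

/-! ### Bol's lemma -/

theorem differentiableOn_iteratedDeriv {f : ℂ → ℂ} {U : Set ℂ} (hU : IsOpen U)
    (hf : DifferentiableOn ℂ f U) (n : ℕ) : DifferentiableOn ℂ (iteratedDeriv n f) U := by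
  induction n with
  | zero => simpa using hf
  | succ n ih => rw [iteratedDeriv_succ]; exact ih.deriv hU

theorem hasDerivAt_iteratedDeriv {f : ℂ → ℂ} {U : Set ℂ} (hU : IsOpen U)
    (hf : DifferentiableOn ℂ f U) (n : ℕ) {z : ℂ} (hz : z ∈ U) :
    HasDerivAt (iteratedDeriv n f) (iteratedDeriv (n + 1) f z) z := by
  rw [iteratedDeriv_succ]
  exact ((differentiableOn_iteratedDeriv hU hf n).differentiableAt (hU.mem_nhds hz)).hasDerivAt

/-- Leibniz' rule for the product with a function whose second derivative vanishes. -/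
theorem iteratedDeriv_affine_mul {h : ℂ → ℂ} {U : Set ℂ} (hU : IsOpen U)
    (hh : DifferentiableOn ℂ h U) (a b : ℂ) (n : ℕ) {z : ℂ} (hz : z ∈ U) :
    iteratedDeriv (n + 1) (fun w => (a + b * w) * h w) z =
      (a + b * z) * iteratedDeriv (n + 1) h z + (n + 1) * b * iteratedDeriv n h z := by
  have haff (z : ℂ) : HasDerivAt (fun w => a + b * w) b z := by
    simpa using ((hasDerivAt_id z).const_mul b).const_add a
  induction n generalizing z with
  | zero =>
    have := ((haff z).mul (hasDerivAt_iteratedDeriv hU hh 0 hz)).deriv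
    simp only [iteratedDeriv_zero, zero_add, iteratedDeriv_one] at this ⊢
    rw [show (fun w => (a + b * w) * h w) = (fun w => a + b * w) * h from rfl, this]
    push_cast
    ring
  | succ n ih =>
    have hev : iteratedDeriv (n + 1) (fun w => (a + b * w) * h w) =ᶠ[𝓝 z] fun z =>
        (a + b * z) * iteratedDeriv (n + 1) h z + (n + 1) * b * iteratedDeriv n h z := by
      filter_upwards [hU.mem_nhds hz] with w hw using ih hw
    rw [iteratedDeriv_succ, hev.deriv_eq]
    have h1 := (haff z).mul (hasDerivAt_iteratedDeriv hU hh (n + 1) hz)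
    have h2 := (hasDerivAt_iteratedDeriv hU hh n hz).const_mul (((n : ℂ) + 1) * b)
    refine (h1.add h2).deriv.trans ?_
    push_cast
    ring

/-- **Bol's lemma**: if `φ` is a Möbius transformation with `φ' w = A / (1 + r * w) ^ 2`, then the
derivative of order `n + 1` of `(φ') ^ (-n / 2) * f ∘ φ` is
`(φ') ^ ((n + 2) / 2) * f ^ (n + 1) ∘ φ`, up to constant factors. -/
theorem iteratedDeriv_affine_pow_mul_comp {f φ : ℂ → ℂ} {U V : Set ℂ} (hU : IsOpen U)
    (hV : IsOpen V) (hf : DifferentiableOn ℂ f V) {r A : ℂ} (hr : ∀ w ∈ U, 1 + r * w ≠ 0)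
    (hφ : ∀ w ∈ U, HasDerivAt φ (A / (1 + r * w) ^ 2) w) (hUV : Set.MapsTo φ U V) (n : ℕ)
    {z : ℂ} (hz : z ∈ U) :
    iteratedDeriv (n + 1) (fun w => (1 + r * w) ^ n * f (φ w)) z =
      A ^ (n + 1) * iteratedDeriv (n + 1) f (φ z) / (1 + r * z) ^ (n + 2) := by
  have haff (z : ℂ) : HasDerivAt (fun w => 1 + r * w) r z := by
    simpa using ((hasDerivAt_id z).const_mul r).const_add 1
  induction n generalizing z with
  | zero =>
    have h1 := (hasDerivAt_iteratedDeriv hV hf 0 (hUV hz)).comp z (hφ z hz)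
    simp only [iteratedDeriv_zero, zero_add, iteratedDeriv_one, pow_zero, one_mul, pow_one] at h1 ⊢
    rw [show (fun w => f (φ w)) = f ∘ φ from rfl, h1.deriv]
    ring
  | succ n ih =>
    have hcomp : DifferentiableOn ℂ (fun w => f (φ w)) U :=
      hf.comp (fun w hw => (hφ w hw).differentiableAt.differentiableWithinAt) hUV
    have hh : DifferentiableOn ℂ (fun w => (1 + r * w) ^ n * f (φ w)) U :=
      DifferentiableOn.mul (by fun_prop) hcomp
    have hev : iteratedDeriv (n + 1) (fun w => (1 + r * w) ^ n * f (φ w)) =ᶠ[𝓝 z] fun z =>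
        A ^ (n + 1) * iteratedDeriv (n + 1) f (φ z) / (1 + r * z) ^ (n + 2) := by
      filter_upwards [hU.mem_nhds hz] with w hw using ih hw
    have hd : iteratedDeriv (n + 2) (fun w => (1 + r * w) ^ n * f (φ w)) z =
        A ^ (n + 2) * iteratedDeriv (n + 2) f (φ z) / (1 + r * z) ^ (n + 4) -
          (n + 2) * r * A ^ (n + 1) * iteratedDeriv (n + 1) f (φ z) / (1 + r * z) ^ (n + 3) := by
      rw [iteratedDeriv_succ, hev.deriv_eq]
      have h1 : HasDerivAt (fun w => iteratedDeriv (n + 1) f (φ w))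
          (iteratedDeriv (n + 2) f (φ z) * (A / (1 + r * z) ^ 2)) z :=
        (hasDerivAt_iteratedDeriv hV hf (n + 1) (hUV hz)).comp z (hφ z hz)
      have h2 : HasDerivAt (fun w => (1 + r * w) ^ (n + 2))
          (((n + 2 : ℕ) : ℂ) * (1 + r * z) ^ (n + 1) * r) z := (haff z).pow (n + 2)
      have h0 := hr z hz
      refine ((h1.const_mul (A ^ (n + 1))).div h2 (pow_ne_zero _ h0)).deriv.trans ?_
      push_cast
      field_simp
      ring
    have key := iteratedDeriv_affine_mul hU hh 1 r (n + 1) hz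
    have e : (fun w => (1 + r * w) ^ (n + 1) * f (φ w)) =
        fun w => (1 + r * w) * ((1 + r * w) ^ n * f (φ w)) := by
      ext w; ring
    rw [e, key, hd, ih hz]
    have h0 := hr z hz
    push_cast
    field_simp
    ring

/-! ### Taylor coefficients -/

theorem iteratedDeriv_pow_mul_div_factorial {g : ℂ → ℂ} {U : Set ℂ} (hU : IsOpen U)
    (hg : DifferentiableOn ℂ g U) (h0 : 0 ∈ U) (k j : ℕ) :
    iteratedDeriv (j + k) (fun w => w ^ k * g w) 0 / (j + k).factorial =
      iteratedDeriv j g 0 / j.factorial := by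
  induction k with
  | zero => simp
  | succ k ih =>
    have hh : DifferentiableOn ℂ (fun w => w ^ k * g w) U :=
      DifferentiableOn.mul (by fun_prop) hg
    have key := iteratedDeriv_affine_mul hU hh 0 1 (j + k) h0
    have e : (fun w => w ^ (k + 1) * g w) = fun w => (0 + 1 * w) * (w ^ k * g w) := by
      ext w; ring
    rw [← ih, ← add_assoc, e, key, Nat.factorial_succ]
    have : ((j + k : ℕ) : ℂ) + 1 ≠ 0 := Nat.cast_add_one_ne_zero _
    have : ((j + k).factorial : ℂ) ≠ 0 := 
      Nat.cast_ne_zero.2 (Nat.factorial_ne_zero _)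
    push_cast at *
    field_simp
    ring

theorem iteratedDeriv_affine_pow_mul_zero {g : ℂ → ℂ} {U : Set ℂ} (hU : IsOpen U)
    (hg : DifferentiableOn ℂ g U) (h0 : 0 ∈ U) (n : ℕ) (r : ℂ) :
    iteratedDeriv (n + 1) (fun w => (1 + r * w) ^ n * g w) 0 =
      (n + 1).factorial * ∑ k ∈ Finset.range (n + 1),
        (n.choose k) * r ^ k * (iteratedDeriv (n + 1 - k) g 0 / (n + 1 - k).factorial) := by
  have e : (fun w => (1 + r * w) ^ n * g w) = fun w => ∑ k ∈ Finset.range (n + 1),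
      ((n.choose k) * r ^ k) * (w ^ k * g w) := by
    ext w
    rw [add_comm, add_pow, Finset.sum_mul]
    refine Finset.sum_congr rfl fun k _ => ?_
    rw [mul_pow]; ring
  have han (k : ℕ) : ContDiffAt ℂ (n + 1 : ℕ) (fun w => w ^ k * g w) 0 :=
    ContDiffAt.mul (by fun_prop) ((hg.analyticAt (hU.mem_nhds h0)).contDiffAt)
  rw [e, iteratedDeriv_fun_sum, Finset.mul_sum]
  · refine Finset.sum_congr rfl fun k hk => ?_
    rw [iteratedDeriv_const_mul_field]
    have hk' : n + 1 - k + k = n + 1 := by have := Finset.mem_range.1 hk; omega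
    have := iteratedDeriv_pow_mul_div_factorial hU hg h0 k (n + 1 - k)
    rw [hk'] at this
    rw [← this]
    have : ((n + 1).factorial : ℂ) ≠ 0 := 
      Nat.cast_ne_zero.2 (Nat.factorial_ne_zero _)
    field_simp
  · intro k _
    exact contDiffAt_const.mul (han k)

open Complex Metric

/-! ### Taylor coefficients and the boundary values of the real part -/

/-- If the Taylor coefficients of `g` of positive order are those of a Schwarz integral with
density `u` on the circle of radius `ρ`, then so is the coefficient of `w ^ (n + 1)` in
`(1 + r * w) ^ n * g w`: the factor being a polynomial of degree at most `n`, the coefficient of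
order zero does not enter. -/
theorem iteratedDeriv_affine_pow_mul_eq_circleAverage {g : ℂ → ℂ} {U : Set ℂ} (hU : IsOpen U)
    (hg : DifferentiableOn ℂ g U) (h0 : 0 ∈ U) {u : ℂ → ℝ} {ρ : ℝ} (hρ : 0 < ρ)
    (hu : CircleIntegrable (fun z => (u z : ℂ)) 0 ρ)
    (hcoeff : ∀ j, 1 ≤ j → iteratedDeriv j g 0 / j.factorial =
      2 * Real.circleAverage (fun z => u z * z⁻¹ ^ j) 0 ρ) (n : ℕ) (r : ℂ) :
    iteratedDeriv (n + 1) (fun w => (1 + r * w) ^ n * g w) 0 = (n + 1).factorial *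
      (2 * Real.circleAverage (fun z => u z * ((1 + r * z) ^ n * z⁻¹ ^ (n + 1))) 0 ρ) := by
  have hne : ∀ z ∈ sphere (0 : ℂ) |ρ|, z ≠ 0 :=
    fun z hz => ne_of_mem_sphere hz (abs_pos.2 hρ.ne').ne'
  have hint (j : ℕ) : CircleIntegrable (fun z => u z * z⁻¹ ^ j) 0 ρ :=
    hu.mul_continuousOn ((continuousOn_inv₀.mono hne).pow j)
  rw [iteratedDeriv_affine_pow_mul_zero hU hg h0]
  congr 1
  have e : Real.circleAverage (fun z => u z * ((1 + r * z) ^ n * z⁻¹ ^ (n + 1))) 0 ρ =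
      Real.circleAverage (fun z => ∑ k ∈ Finset.range (n + 1),
        ((n.choose k) * r ^ k) • (u z * z⁻¹ ^ (n + 1 - k))) 0 ρ := by
    refine Real.circleAverage_congr_sphere fun z hz => ?_
    have hz0 := hne z hz
    simp only [smul_eq_mul]
    rw [add_comm, add_pow, Finset.sum_mul, Finset.mul_sum]
    refine Finset.sum_congr rfl fun k hk => ?_
    have hk' : n + 1 = n + 1 - k + k := by have := Finset.mem_range.1 hk; omega
    have : z⁻¹ ^ (n + 1) = z⁻¹ ^ (n + 1 - k) * z⁻¹ ^ k := by rw [← pow_add, ← hk']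
    rw [this, mul_pow, one_pow]
    simp only [inv_pow]
    field_simp
  rw [e, Real.circleAverage_fun_sum (f := fun k z =>
    ((n.choose k) * r ^ k) • (u z * z⁻¹ ^ (n + 1 - k))) fun k _ => (hint _).const_smul,
    Finset.mul_sum]
  refine Finset.sum_congr rfl fun k hk => ?_
  rw [Real.circleAverage_fun_smul, hcoeff _ (by have := Finset.mem_range.1 hk; omega)]
  simp only [smul_eq_mul]
  ring

/-- The Taylor coefficients of a holomorphic function in terms of its real part. -/
theorem iteratedDeriv_div_factorial_eq_circleAverage_re {g : ℂ → ℂ}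
    (hg : DifferentiableOn ℂ g (ball 0 1)) {ρ : ℝ} (hρ : 0 < ρ) (hρ1 : ρ < 1) {j : ℕ}
    (hj : 1 ≤ j) : iteratedDeriv j g 0 / j.factorial =
      2 * Real.circleAverage (fun z => ((g z).re : ℂ) * z⁻¹ ^ j) 0 ρ := by
  have hρa : |ρ| = ρ := abs_of_pos hρ
  have hne : ∀ z ∈ sphere (0 : ℂ) |ρ|, z ≠ 0 :=
    fun z hz => ne_of_mem_sphere hz (abs_pos.2 hρ.ne').ne'
  have hgd : DifferentiableOn ℂ g (closedBall 0 ρ) := hg.mono (closedBall_subset_ball hρ1)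
  have hgc : ContinuousOn g (sphere 0 |ρ|) := by
    rw [hρa]; exact hgd.continuousOn.mono sphere_subset_closedBall
  have hinv : ContinuousOn (fun z : ℂ => z⁻¹ ^ j) (sphere 0 |ρ|) :=
    (continuousOn_inv₀.mono hne).pow j
  have h1 : Real.circleAverage (fun z => g z * z⁻¹ ^ j) 0 ρ =
      iteratedDeriv j g 0 / j.factorial := by
    rw [Real.circleAverage_eq_circleIntegral hρ.ne']
    have := hgd.circleIntegral_one_div_sub_center_pow_smul hρ j
    have e : (∮ z in C(0, ρ), (z - 0)⁻¹ • (g z * z⁻¹ ^ j)) =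
        ∮ z in C(0, ρ), (1 / (z - 0) ^ (j + 1)) • g z := by
      refine circleIntegral.integral_congr hρ.le fun z _ => ?_
      simp only [sub_zero, smul_eq_mul]
      ring
    rw [e, this, smul_smul, smul_eq_mul]
    have : (2 * Real.pi * I : ℂ) ≠ 0 := two_pi_I_ne_zero
    field_simp
  -- the mean value property of `g z * z ^ j`, conjugated
  have h2 : Real.circleAverage (fun z => (starRingEnd ℂ) (g z) * z⁻¹ ^ j) 0 ρ = 0 := by
    have hd : DifferentiableOn ℂ (fun z => g z * z ^ j) (closedBall 0 |ρ|) := by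
      rw [hρa]; exact hgd.mul (by fun_prop)
    have hm : Real.circleAverage (fun z => g z * z ^ j) 0 ρ = 0 := by
      rw [(hd.mono closure_ball_subset_closedBall).diffContOnCl.circleAverage]
      simp [show j ≠ 0 by omega]
    have hi : CircleIntegrable (fun z => g z * z ^ j) 0 ρ :=
      ContinuousOn.circleIntegrable' (hgc.mul (by fun_prop))
    have hc := (conjCLE : ℂ →L[ℝ] ℂ).circleAverage_comp_comm hi
    rw [hm, map_zero] at hc
    have e : Real.circleAverage (fun z => (starRingEnd ℂ) (g z) * z⁻¹ ^ j) 0 ρ =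
        Real.circleAverage (fun z => ((ρ : ℂ) ^ (2 * j))⁻¹ •
          ((conjCLE : ℂ →L[ℝ] ℂ) ∘ fun z => g z * z ^ j) z) 0 ρ := by
      refine Real.circleAverage_congr_sphere fun z hz => ?_
      have hz0 := hne z hz
      have hn : z * (starRingEnd ℂ) z = (ρ : ℂ) ^ 2 := by
        rw [mul_conj, normSq_eq_norm_sq, show ‖z‖ = ρ by simpa [hρa] using hz]
        push_cast; rfl
      have hρ0 : (ρ : ℂ) ≠ 0 := by exact_mod_cast hρ.ne'
      simp only [Function.comp_apply, smul_eq_mul, ContinuousLinearEquiv.coe_coe, conjCLE_apply,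
        map_mul, map_pow]
      rw [pow_mul, ← hn, mul_pow]
      have : (starRingEnd ℂ) z ≠ 0 := by simpa using hz0
      simp only [inv_pow]
      field_simp
    rw [e, Real.circleAverage_fun_smul]
    rw [hc, smul_zero]
  have e : Real.circleAverage (fun z => ((g z).re : ℂ) * z⁻¹ ^ j) 0 ρ =
      Real.circleAverage (fun z => (2 : ℂ)⁻¹ •
        (g z * z⁻¹ ^ j + (starRingEnd ℂ) (g z) * z⁻¹ ^ j)) 0 ρ := by
    congr 1
    ext1 z
    rw [re_eq_add_conj, smul_eq_mul]
    ring
  rw [e, Real.circleAverage_fun_smul, Real.circleAverage_fun_add, h1, h2]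
  · simp
  · exact ContinuousOn.circleIntegrable' (hgc.mul hinv)
  · exact ContinuousOn.circleIntegrable' ((continuous_conj.comp_continuousOn hgc).mul hinv)

/-! ### The extremal integral -/

/-- The substitution `z = exp (2 * φ * I)` turns the average of the extremal kernel over the unit
circle into the integral that defines `K`. -/
theorem circleAverage_abs_re_kernel (n : ℕ) (α : ℝ) :
    Real.circleAverage (fun z => |(exp (-α * I) * ((1 + z) ^ n * z⁻¹ ^ (n + 1))).re|) 0 1 =
      2 ^ n / Real.pi * cosIntegral (n + 1) α := by
  set F : ℝ → ℝ := fun ψ =>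
    |(exp (-α * I) * ((1 + circleMap 0 1 ψ) ^ n * (circleMap 0 1 ψ)⁻¹ ^ (n + 1))).re| with hF
  have hper : Function.Periodic F (2 * Real.pi) := by
    intro ψ
    simp only [hF, periodic_circleMap 0 1 ψ]
  have h1 : (∫ ψ in (0 : ℝ)..2 * Real.pi, F ψ) = ∫ ψ in (-Real.pi)..Real.pi, F ψ := by
    have := hper.intervalIntegral_add_eq 0 (-Real.pi)
    rwa [zero_add, show -Real.pi + 2 * Real.pi = Real.pi by ring] at this
  have h2 : (∫ ψ in (-Real.pi)..Real.pi, F ψ) =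
      2 * ∫ φ in (-(Real.pi / 2))..(Real.pi / 2), F (2 * φ) := by
    rw [intervalIntegral.integral_comp_mul_left _ two_ne_zero]
    simp only [smul_eq_mul]
    rw [show 2 * -(Real.pi / 2) = -Real.pi by ring, show 2 * (Real.pi / 2) = Real.pi by ring]
    ring
  have h3 : (∫ φ in (-(Real.pi / 2))..(Real.pi / 2), F (2 * φ)) =
      2 ^ n * cosIntegral (n + 1) α := by
    rw [cosIntegral, ← intervalIntegral.integral_const_mul]
    refine intervalIntegral.integral_congr fun φ hφ => ?_
    rw [Set.uIcc_of_le (by linarith [Real.pi_pos])] at hφ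
    have hcos : 0 ≤ Real.cos φ := Real.cos_nonneg_of_mem_Icc hφ
    have hk : exp (-α * I) * ((1 + circleMap 0 1 (2 * φ)) ^ n *
        (circleMap 0 1 (2 * φ))⁻¹ ^ (n + 1)) =
        ((2 ^ n * Real.cos φ ^ n : ℝ) : ℂ) *
          exp ((-(α + (((n + 1 : ℕ) : ℝ) + 1) * φ) : ℝ) * I) := by
      have hE : circleMap 0 1 (2 * φ) = exp (φ * I) * exp (φ * I) := by
        rw [circleMap_zero, ← Complex.exp_add]; push_cast; ring_nf
      have hE0 : exp (φ * I) ≠ 0 := exp_ne_zero _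
      have hsum : 1 + circleMap 0 1 (2 * φ) = 2 * Real.cos φ * exp (φ * I) := by
        rw [hE, ofReal_cos, Complex.two_cos, add_mul, ← Complex.exp_add, ← Complex.exp_add]
        simp
        ring
      have hang : exp ((-(α + (((n + 1 : ℕ) : ℝ) + 1) * φ) : ℝ) * I) =
          exp (-α * I) * (exp (φ * I))⁻¹ ^ (n + 2) := by
        rw [← Complex.exp_neg, ← Complex.exp_nat_mul, ← Complex.exp_add]
        push_cast; ring_nf
      rw [hsum, hE, hang]
      push_cast
      simp only [mul_pow, mul_inv, inv_pow]
      field_simp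
      ring
    simp only [hF]
    rw [hk, re_ofReal_mul, exp_ofReal_mul_I_re, abs_mul, Real.cos_neg,
      abs_of_nonneg (by positivity), Nat.add_sub_cancel]
    ring
  rw [Real.circleAverage_def, h1, h2, h3, smul_eq_mul]
  field_simp

theorem cosIntegral_zero_pos (n : ℕ) : 0 < cosIntegral (n + 1) 0 := by
  refine intervalIntegral.integral_pos (by linarith [Real.pi_pos]) (by fun_prop)
    (fun φ hφ => ?_) ⟨0, ?_, by simp⟩
  · have := Real.cos_nonneg_of_mem_Icc ⟨hφ.1.le, hφ.2⟩
    positivity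
  · constructor <;> linarith [Real.pi_pos]

theorem cosIntegral_le_iSup (s : ℕ) (α : ℝ) : cosIntegral s α ≤ ⨆ α : ℝ, cosIntegral s α :=
  (isGreatest_cosIntegral s).2 ⟨α, rfl⟩

theorem K_pos (n : ℕ) : 0 < K (n + 1) := by
  have := (cosIntegral_zero_pos n).trans_le (cosIntegral_le_iSup _ _)
  have := Real.pi_pos
  unfold K
  positivity

/-! ### Duality between densities and kernels -/

theorem circleIntegrable_ofReal {u : ℂ → ℝ} {c : ℂ} {R : ℝ} (hu : CircleIntegrable u c R) :
    CircleIntegrable (fun z => (u z : ℂ)) c R := by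
  simp only [CircleIntegrable, intervalIntegrable_iff] at hu ⊢
  exact Complex.ofRealCLM.integrable_comp hu

theorem re_mul_circleAverage {u : ℂ → ℝ} {q : ℂ → ℂ} {ρ : ℝ}
    (h : CircleIntegrable (fun z => u z * q z) 0 ρ) (a : ℂ) :
    (a * Real.circleAverage (fun z => u z * q z) 0 ρ).re =
      Real.circleAverage (fun z => u z * (a * q z).re) 0 ρ := by
  have h' : CircleIntegrable (fun z => a • (u z * q z)) 0 ρ := h.const_smul
  have := reCLM.circleAverage_comp_comm h'
  rw [Real.circleAverage_fun_smul, smul_eq_mul, reCLM_apply] at this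
  rw [← this]
  congr 1
  ext1 z
  rw [Function.comp_apply, reCLM_apply, smul_eq_mul, mul_left_comm, re_ofReal_mul]

/-- A real density bounded by one pairs with a complex kernel `q` to at most the `L¹` norm of the
real part of a rotation of `q`. -/
theorem exists_norm_circleAverage_le {u : ℂ → ℝ} {q : ℂ → ℂ} {ρ : ℝ}
    (hu : ∀ z ∈ sphere (0 : ℂ) |ρ|, |u z| ≤ 1) (hq : ContinuousOn q (sphere 0 |ρ|))
    (hui : CircleIntegrable u 0 ρ) :
    ∃ α : ℝ, ‖Real.circleAverage (fun z => u z * q z) 0 ρ‖ ≤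
      Real.circleAverage (fun z => |(exp (-α * I) * q z).re|) 0 ρ := by
  have hint : CircleIntegrable (fun z => u z * q z) 0 ρ :=
    (circleIntegrable_ofReal hui).mul_continuousOn hq
  set X := Real.circleAverage (fun z => u z * q z) 0 ρ with hX
  refine ⟨arg X, ?_⟩
  have hrot : exp (-arg X * I) * X = ‖X‖ := by
    conv_lhs => rw [← norm_mul_exp_arg_mul_I X]
    rw [mul_left_comm, norm_mul_exp_arg_mul_I, ← Complex.exp_add]
    simp
  have hre : ‖X‖ = (exp (-arg X * I) * X).re := by rw [hrot, ofReal_re]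
  have hqr : ContinuousOn (fun z => (exp (-arg X * I) * q z).re) (sphere 0 |ρ|) :=
    continuous_re.comp_continuousOn (continuousOn_const.mul hq)
  rw [hre, re_mul_circleAverage hint]
  refine Real.circleAverage_mono (hui.mul_continuousOn hqr)
    (ContinuousOn.circleIntegrable' hqr.abs) fun z hz => ?_
  refine (le_abs_self _).trans ?_
  rw [abs_mul]
  exact mul_le_of_le_one_left (abs_nonneg _) (hu z hz)

/-- The `L¹` distance on the unit circle between `(1 + r ^ 2 * z) ^ n` and its limit as `r` tends
to `1`. -/
noncomputable def kernelDefect (n : ℕ) (r : ℝ) : ℝ :=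
  Real.circleAverage (fun z => ‖(1 + (r : ℂ) ^ 2 * z) ^ n - (1 + z) ^ n‖) 0 1

theorem continuous_kernelDefect (n : ℕ) : Continuous (kernelDefect n) := by
  have hc : Continuous (fun p : ℝ × ℝ => circleMap 0 1 p.2) :=
    (continuous_circleMap 0 1).comp continuous_snd
  have h : Continuous fun r : ℝ => ∫ θ in (0 : ℝ)..2 * Real.pi,
      ‖(1 + (r : ℂ) ^ 2 * circleMap 0 1 θ) ^ n - (1 + circleMap 0 1 θ) ^ n‖ := by
    apply intervalIntegral.continuous_parametric_intervalIntegral_of_continuous'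
    fun_prop
  exact h.const_smul (2 * Real.pi)⁻¹

theorem kernelDefect_one (n : ℕ) : kernelDefect n 1 = 0 := by
  simp [kernelDefect, Real.circleAverage_const]

/-- The kernel on the circle of radius `r`, rescaled to the unit circle, differs from the limit
kernel by `kernelDefect n r` in `L¹`. -/
theorem norm_circleAverage_mul_kernel_le {u : ℂ → ℝ} {r : ℝ} (hr : 0 < r)
    (hu : ∀ z ∈ sphere (0 : ℂ) |r|, |u z| ≤ 1) (hui : CircleIntegrable u 0 r) (n : ℕ) :
    r ^ (n + 1) *
        ‖Real.circleAverage (fun z => u z * ((1 + r * z) ^ n * z⁻¹ ^ (n + 1))) 0 r‖ ≤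
      2 ^ n / Real.pi * (⨆ α : ℝ, cosIntegral (n + 1) α) + kernelDefect n r := by
  have hinv (ρ : ℝ) (hρ : 0 < ρ) :
      ContinuousOn (fun z : ℂ => z⁻¹ ^ (n + 1)) (sphere 0 |ρ|) :=
    (continuousOn_inv₀.mono fun z hz => ne_of_mem_sphere hz (abs_pos.2 hρ.ne').ne').pow _
  have hq (ρ : ℝ) (hρ : 0 < ρ) (a : ℂ) :
      ContinuousOn (fun z : ℂ => (1 + a * z) ^ n * z⁻¹ ^ (n + 1)) (sphere 0 |ρ|) :=
    ContinuousOn.mul (by fun_prop) (hinv ρ hρ)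
  obtain ⟨α, hα⟩ := exists_norm_circleAverage_le hu (hq r hr r) hui
  have hscale : r ^ (n + 1) *
      Real.circleAverage (fun z => |(exp (-α * I) * ((1 + r * z) ^ n * z⁻¹ ^ (n + 1))).re|) 0 r =
      Real.circleAverage (fun z =>
        |(exp (-α * I) * ((1 + (r : ℂ) ^ 2 * z) ^ n * z⁻¹ ^ (n + 1))).re|) 0 1 := by
    rw [Real.circleAverage_eq_circleAverage_zero_one, ← smul_eq_mul,
      ← Real.circleAverage_fun_smul]
    congr 1
    ext1 z
    have hr0 : (r : ℂ) ≠ 0 := by exact_mod_cast hr.ne'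
    rw [smul_eq_mul, ← abs_of_pos (pow_pos hr (n + 1)), ← abs_mul, ← re_ofReal_mul]
    congr 2
    rw [add_zero, mul_inv, mul_pow, ← mul_assoc (r : ℂ) r z, ← sq]
    push_cast
    simp only [inv_pow]
    field_simp
  have hone : ∀ z ∈ sphere (0 : ℂ) |1|,
      |(exp (-α * I) * ((1 + (r : ℂ) ^ 2 * z) ^ n * z⁻¹ ^ (n + 1))).re| ≤
        |(exp (-α * I) * ((1 + z) ^ n * z⁻¹ ^ (n + 1))).re| +
          ‖(1 + (r : ℂ) ^ 2 * z) ^ n - (1 + z) ^ n‖ := by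
    intro z hz
    have hz1 : ‖z‖ = 1 := by simpa using hz
    have hsub : exp (-α * I) * ((1 + (r : ℂ) ^ 2 * z) ^ n * z⁻¹ ^ (n + 1)) =
        exp (-α * I) * ((1 + z) ^ n * z⁻¹ ^ (n + 1)) +
          exp (-α * I) * (((1 + (r : ℂ) ^ 2 * z) ^ n - (1 + z) ^ n) * z⁻¹ ^ (n + 1)) := by ring
    rw [hsub, add_re]
    refine (abs_add_le _ _).trans (add_le_add_right ((abs_re_le_norm _).trans_eq ?_) _)
    rw [norm_mul, norm_mul, norm_pow, norm_inv, hz1,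
      show -(α : ℂ) * I = ((-α : ℝ) : ℂ) * I by push_cast; ring, norm_exp_ofReal_mul_I]
    simp
  have hq1 (a : ℂ) : CircleIntegrable
      (fun z => |(exp (-α * I) * ((1 + a * z) ^ n * z⁻¹ ^ (n + 1))).re|) 0 1 :=
    ContinuousOn.circleIntegrable'
      (continuous_re.comp_continuousOn (continuousOn_const.mul (hq 1 one_pos a))).abs
  have hq1' := hq1 1
  simp only [one_mul] at hq1'
  have hdef : CircleIntegrable (fun z => ‖(1 + (r : ℂ) ^ 2 * z) ^ n - (1 + z) ^ n‖) 0 1 :=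
    ContinuousOn.circleIntegrable' (by fun_prop)
  calc _ ≤ r ^ (n + 1) * Real.circleAverage
        (fun z => |(exp (-α * I) * ((1 + r * z) ^ n * z⁻¹ ^ (n + 1))).re|) 0 r := by gcongr
    _ ≤ _ := by
      rw [hscale]
      refine (Real.circleAverage_mono (hq1 _) (hq1'.add hdef) hone).trans ?_
      rw [Real.circleAverage_add hq1' hdef, circleAverage_abs_re_kernel]
      have := Real.pi_pos
      exact add_le_add_left (mul_le_mul_of_nonneg_left (cosIntegral_le_iSup _ _)
        (by positivity)) _

/-! ### Automorphisms of the unit disk -/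

/-- The automorphism `w ↦ (r + w) / (1 + r * w)` of the unit disk, for `|r| < 1`. -/
noncomputable def mobius (r : ℝ) (w : ℂ) : ℂ := (r + w) / (1 + r * w)

theorem mobius_zero (r : ℝ) : mobius r 0 = r := by simp [mobius]

theorem one_add_mul_ne_zero {r : ℝ} (hr : |r| < 1) {w : ℂ} (hw : w ∈ ball (0 : ℂ) 1) :
    1 + r * w ≠ 0 := by
  intro h
  have h1 : ‖(r : ℂ) * w‖ = 1 := by rw [← neg_eq_of_add_eq_zero_right h]; simp
  have hw1 : ‖w‖ < 1 := by simpa using hw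
  rw [norm_mul, norm_real, Real.norm_eq_abs] at h1
  nlinarith [abs_nonneg r, norm_nonneg w]

theorem mobius_mem_ball {r : ℝ} (hr : |r| < 1) {w : ℂ} (hw : w ∈ ball (0 : ℂ) 1) :
    mobius r w ∈ ball (0 : ℂ) 1 := by
  have h0 := one_add_mul_ne_zero hr hw
  have hw1 : ‖w‖ < 1 := by simpa using hw
  rw [mem_ball_zero_iff, mobius, norm_div, div_lt_one (norm_pos_iff.2 h0)]
  refine lt_of_pow_lt_pow_left₀ 2 (norm_nonneg _) ?_
  have hr2 : r ^ 2 < 1 := (sq_lt_one_iff_abs_lt_one r).2 hr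
  have hw2 : w.re ^ 2 + w.im ^ 2 < 1 := by
    have : ‖w‖ ^ 2 < 1 := by nlinarith [norm_nonneg w]
    rw [Complex.sq_norm, normSq_apply] at this
    nlinarith
  rw [Complex.sq_norm, Complex.sq_norm, normSq_apply, normSq_apply]
  simp
  nlinarith [mul_pos (sub_pos.2 hr2) (sub_pos.2 hw2)]

theorem hasDerivAt_mobius {r : ℝ} (hr : |r| < 1) {w : ℂ} (hw : w ∈ ball (0 : ℂ) 1) :
    HasDerivAt (mobius r) ((1 - (r : ℂ) ^ 2) / (1 + r * w) ^ 2) w := by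
  have h1 : HasDerivAt (fun w : ℂ => (r : ℂ) + w) 1 w := (hasDerivAt_id w).const_add _
  have h2 : HasDerivAt (fun w : ℂ => 1 + (r : ℂ) * w) r w := by
    simpa using ((hasDerivAt_id w).const_mul (r : ℂ)).const_add 1
  refine (h1.div h2 (one_add_mul_ne_zero hr hw)).congr_deriv ?_
  ring

theorem differentiableOn_comp_mobius {g : ℂ → ℂ} (hg : DifferentiableOn ℂ g (ball 0 1)) {r : ℝ}
    (hr : |r| < 1) : DifferentiableOn ℂ (fun w => g (mobius r w)) (ball 0 1) :=
  hg.comp (fun _ hw => (hasDerivAt_mobius hr hw).differentiableAt.differentiableWithinAt)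
    fun _ hw => mobius_mem_ball hr hw

theorem norm_one_sub_ofReal_sq {r : ℝ} (hr : |r| < 1) :
    ‖(1 : ℂ) - (r : ℂ) ^ 2‖ = (1 - r) * (1 + r) := by
  have h : (1 : ℂ) - (r : ℂ) ^ 2 = (((1 - r) * (1 + r) : ℝ) : ℂ) := by push_cast; ring
  have := abs_lt.1 hr
  rw [h, norm_real, Real.norm_of_nonneg (mul_nonneg (by linarith) (by linarith))]

theorem mobius_neg_mobius {r : ℝ} (hr : |r| < 1) {w : ℂ} (hw : w ∈ ball (0 : ℂ) 1) :
    mobius (-r) (mobius r w) = w := by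
  have h0 := one_add_mul_ne_zero hr hw
  have h1 := one_add_mul_ne_zero (r := -r) (by rwa [abs_neg]) (mobius_mem_ball hr hw)
  rw [mobius, div_eq_iff h1]
  simp only [mobius]
  push_cast
  field_simp
  ring

/-! ### The upper estimate -/

/-- A bound for `((1 - r) * R) ^ (n + 1) * |f^{(n + 1)}|` at the point that divides a radius, of
length `R`, in the ratio `r : 1 - r`; it tends to `K (n + 1)` as `r` tends to `1`. -/
noncomputable def radialBound (n : ℕ) (r : ℝ) : ℝ :=
  (n + 1).factorial * (2 * (2 ^ n / Real.pi * (⨆ α : ℝ, cosIntegral (n + 1) α) +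
    kernelDefect n r)) / (r * (1 + r)) ^ (n + 1)

theorem tendsto_radialBound (n : ℕ) :
    Filter.Tendsto (radialBound n) (𝓝 1) (𝓝 (K (n + 1))) := by
  have hc : ContinuousAt (radialBound n) 1 := by
    have := (continuous_kernelDefect n).continuousAt (x := 1)
    unfold radialBound
    refine ContinuousAt.div (by fun_prop) (by fun_prop) (by norm_num)
  have : radialBound n 1 = K (n + 1) := by
    rw [radialBound, kernelDefect_one, K]
    have := Real.pi_ne_zero
    field_simp
    ring
  rw [← this]
  exact hc

theorem hasDerivAt_add_mul_mobius {c a : ℂ} {r : ℝ} (hr : |r| < 1) {w : ℂ}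
    (hw : w ∈ ball (0 : ℂ) 1) :
    HasDerivAt (fun w => c + a * mobius r w) (a * (1 - (r : ℂ) ^ 2) / (1 + r * w) ^ 2) w := by
  rw [mul_div_assoc]
  exact ((hasDerivAt_mobius hr hw).const_mul a).const_add c

theorem norm_iteratedDeriv_le_radialBound {f : ℂ → ℂ} {c ζ : ℂ} {R : ℝ} (hR : 0 < R)
    (hζ : ‖ζ - c‖ = R) (hf : DifferentiableOn ℂ f (ball c R))
    (hre : ∀ z ∈ ball c R, |(f z).re| ≤ 1) {r : ℝ} (hr : 0 < r) (hr1 : r < 1) (n : ℕ) :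
    ((1 - r) * R) ^ (n + 1) * ‖iteratedDeriv (n + 1) f (c + (ζ - c) * r)‖ ≤ radialBound n r := by
  have hra : |r| < 1 := by rwa [abs_of_pos hr]
  set φ : ℂ → ℂ := fun w => c + (ζ - c) * mobius r w with hφ
  have hmaps : Set.MapsTo φ (ball 0 1) (ball c R) := by
    intro w hw
    have := mem_ball_zero_iff.1 (mobius_mem_ball hra hw)
    rw [mem_ball_iff_norm, hφ, add_sub_cancel_left, norm_mul, hζ]
    exact mul_lt_of_lt_one_right hR this
  have hder : ∀ w ∈ ball (0 : ℂ) 1,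
      HasDerivAt φ ((ζ - c) * (1 - (r : ℂ) ^ 2) / (1 + r * w) ^ 2) w :=
    fun w hw => hasDerivAt_add_mul_mobius hra hw
  have h0 : (0 : ℂ) ∈ ball (0 : ℂ) 1 := mem_ball_self one_pos
  have hg : DifferentiableOn ℂ (fun w => f (φ w)) (ball 0 1) :=
    hf.comp (fun w hw => (hder w hw).differentiableAt.differentiableWithinAt) hmaps
  have hbol := iteratedDeriv_affine_pow_mul_comp isOpen_ball isOpen_ball hf
    (fun w hw => one_add_mul_ne_zero hra hw) hder hmaps n h0
  -- the circle of radius `r` lies in the disk and tends to its boundary as `r` tends to `1`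
  have hsub : sphere (0 : ℂ) |r| ⊆ ball 0 1 := by
    rw [abs_of_pos hr]; exact sphere_subset_closedBall.trans (closedBall_subset_ball hr1)
  have hcont : ContinuousOn (fun w => (f (φ w)).re) (sphere 0 |r|) :=
    continuous_re.comp_continuousOn (hg.continuousOn.mono hsub)
  have hkernel := norm_circleAverage_mul_kernel_le (u := fun w => (f (φ w)).re) hr
    (fun z hz => hre _ (hmaps (hsub hz))) hcont.circleIntegrable' n
  have hcoeff := iteratedDeriv_affine_pow_mul_eq_circleAverage isOpen_ball hg h0
    (u := fun w => (f (φ w)).re) hr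
    (ContinuousOn.circleIntegrable' (continuous_ofReal.comp_continuousOn hcont))
    (fun j hj => iteratedDeriv_div_factorial_eq_circleAverage_re hg hr hr1 hj) n r
  rw [hcoeff] at hbol
  have hφ0 : φ 0 = c + (ζ - c) * r := by rw [hφ]; simp only [mobius_zero]
  rw [hφ0] at hbol
  have hnorm := congrArg norm hbol
  simp only [norm_mul, norm_pow, norm_one_sub_ofReal_sq hra, hζ, norm_natCast, mul_zero,
    add_zero, one_pow, div_one, RCLike.norm_ofNat] at hnorm
  set X := ‖Real.circleAverage
    (fun z => ((f (φ z)).re : ℂ) * ((1 + r * z) ^ n * z⁻¹ ^ (n + 1))) 0 r‖ with hX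
  rw [radialBound, le_div_iff₀ (by positivity)]
  calc ((1 - r) * R) ^ (n + 1) * ‖iteratedDeriv (n + 1) f (c + (ζ - c) * r)‖ *
        (r * (1 + r)) ^ (n + 1)
      = r ^ (n + 1) * ((R * ((1 - r) * (1 + r))) ^ (n + 1) *
          ‖iteratedDeriv (n + 1) f (c + (ζ - c) * r)‖) := by
        simp only [mul_pow]; ring
    _ = (n + 1).factorial * (2 * (r ^ (n + 1) * X)) := by rw [← hnorm]; ring
    _ ≤ _ := by gcongr

theorem radialLimsup_le {Ω : Set ℂ} {ζ c : ℂ} {R : ℝ} (h : TouchedByDisk Ω ζ c R) (n : ℕ) :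
    radialLimsup (n + 1) Ω ζ c ≤ ENNReal.ofReal (K (n + 1)) := by
  have hR := h.radius_pos
  have hζ : ‖ζ - c‖ = R := mem_sphere_iff_norm.1 h.mem_circle
  have hne : (𝓝[openSegment ℝ c ζ] ζ).NeBot := by
    rw [← mem_closure_iff_nhdsWithin_neBot, closure_openSegment]
    exact right_mem_segment ℝ c ζ
  have hlim : Filter.Tendsto
      (fun z : ℂ => ENNReal.ofReal (radialBound n (1 - ‖z - ζ‖ / R)))
      (𝓝[openSegment ℝ c ζ] ζ) (𝓝 (ENNReal.ofReal (K (n + 1)))) := by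
    refine ENNReal.tendsto_ofReal ((tendsto_radialBound n).comp ?_)
    have hc : Continuous fun z : ℂ => 1 - ‖z - ζ‖ / R := by fun_prop
    have := hc.tendsto ζ
    simp only [sub_self, norm_zero, zero_div, sub_zero] at this
    exact this.mono_left nhdsWithin_le_nhds
  rw [radialLimsup, ← hlim.limsup_eq]
  refine Filter.limsup_le_limsup ?_
  filter_upwards [self_mem_nhdsWithin] with z hz
  refine iSup₂_le fun f hf => ENNReal.ofReal_le_ofReal ?_
  rw [openSegment_eq_image'] at hz
  obtain ⟨r, ⟨hr0, hr1⟩, rfl⟩ := hz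
  have hz' : c + r • (ζ - c) = c + (ζ - c) * r := by rw [real_smul, mul_comm]
  have hd : ‖c + r • (ζ - c) - ζ‖ = (1 - r) * R := by
    have : c + r • (ζ - c) - ζ = ((r - 1 : ℝ) : ℂ) * (ζ - c) := by
      rw [hz']; push_cast; ring
    rw [this, norm_mul, hζ, norm_real, Real.norm_eq_abs, abs_sub_comm, abs_of_pos (by linarith)]
  have hr : 1 - ‖c + r • (ζ - c) - ζ‖ / R = r := by
    rw [hd, mul_div_cancel_right₀ _ hR.ne']; ring
  simp only [hr]
  rw [hd, hz']
  exact norm_iteratedDeriv_le_radialBound hR hζ (hf.1.mono h.disk_subset)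
    (fun z hz => hf.2 z (h.disk_subset hz)) hr0 hr1 n

/-! ### Extremal functions -/

/-- The Schwarz integral: the holomorphic function in the unit disk whose real part is the Poisson
integral of the density `u`. -/
noncomputable def schwarzIntegral (u : ℂ → ℝ) (w : ℂ) : ℂ :=
  Real.circleAverage (fun z => herglotzRieszKernel 0 w z • (u z : ℂ)) 0 1

theorem differentiableOn_schwarzIntegral {u : ℂ → ℝ} (hu : CircleIntegrable u 0 1) :
    DifferentiableOn ℂ (schwarzIntegral u) (ball 0 1) :=
  differentiableOn_circleAverage_herglotzRieszKernel_smul (circleIntegrable_ofReal hu)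

theorem abs_re_schwarzIntegral_le {u : ℂ → ℝ} (hu : CircleIntegrable u 0 1)
    (hu1 : ∀ z, |u z| ≤ 1) {w : ℂ} (hw : w ∈ ball (0 : ℂ) 1) :
    |(schwarzIntegral u w).re| ≤ 1 := by
  set P : ℂ → ℝ := re ∘ herglotzRieszKernel 0 w with hP
  have hPc : ContinuousOn P (sphere 0 |1|) :=
    continuous_re.comp_continuousOn (continuousOn_herglotzRieszKernel_sphere hw)
  have hPi : CircleIntegrable P 0 1 := hPc.circleIntegrable'
  have hone : Real.circleAverage P 0 1 = 1 := by
    have h1 : Real.circleAverage ((re ∘ herglotzRieszKernel 0 w) • fun _ => (1 : ℂ)) 0 1 = 1 :=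
      DiffContOnCl.circleAverage_re_herglotzRieszKernel_smul diffContOnCl_const hw
    have h2 := ofRealCLM.circleAverage_comp_comm hPi
    have e : (⇑ofRealCLM ∘ P) = (re ∘ herglotzRieszKernel 0 w) • fun _ => (1 : ℂ) := by
      ext1 z; simp [hP]
    rw [e, h1] at h2
    rw [ofRealCLM_apply] at h2
    exact_mod_cast h2.symm
  rw [schwarzIntegral, re_circleAverage_herglotzRieszKernel_smul hu hw]
  refine Real.abs_circleAverage_le_circleAverage_abs.trans ?_
  have hPu : CircleIntegrable (P • u) 0 1 := hu.continuousOn_smul hPc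
  refine (Real.circleAverage_mono hPu.abs hPi fun z hz => ?_).trans_eq hone
  have hz1 : ‖z‖ = 1 := by simpa using hz
  have hPz : 0 ≤ P z := by
    rw [hP, ← poissonKernel_eq_re_herglotzRieszKernel, poissonKernel_def]
    have : ‖w‖ < 1 := by simpa using hw
    simp only [sub_zero, hz1]
    have : 0 ≤ 1 ^ 2 - ‖w‖ ^ 2 := by nlinarith [norm_nonneg w]
    positivity
  change |P z * u z| ≤ P z
  rw [abs_mul, abs_of_nonneg hPz]
  exact mul_le_of_le_one_right hPz (hu1 z)

theorem schwarzIntegral_eq_circleIntegral {u : ℂ → ℝ} (hu : CircleIntegrable u 0 1) {w : ℂ}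
    (hw : w ∈ ball (0 : ℂ) 1) :
    schwarzIntegral u w = -Real.circleAverage (fun z => (u z : ℂ)) 0 1 +
      2 * ((2 * Real.pi * I : ℂ)⁻¹ • ∮ z in C(0, 1), (z - w)⁻¹ • (u z : ℂ)) := by
  have huc := circleIntegrable_ofReal hu
  have hcauchy : Real.circleAverage (fun z => (z / (z - w)) * (u z : ℂ)) 0 1 =
      (2 * Real.pi * I : ℂ)⁻¹ • ∮ z in C(0, 1), (z - w)⁻¹ • (u z : ℂ) := by
    rw [Real.circleAverage_eq_circleIntegral one_ne_zero]
    congr 1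
    refine circleIntegral.integral_congr zero_le_one fun z hz => ?_
    have hz0 : z ≠ 0 := ne_of_mem_sphere hz one_ne_zero
    simp only [sub_zero, smul_eq_mul]
    rw [div_eq_mul_inv, mul_assoc, inv_mul_cancel_left₀ hz0]
  have hzw : ∀ z ∈ sphere (0 : ℂ) |1|, z - w ≠ 0 := by
    intro z hz h
    rw [sub_eq_zero.1 h] at hz
    have h1 : ‖w‖ = 1 := by simpa using hz
    have : ‖w‖ < 1 := by simpa using hw
    linarith
  have hi : CircleIntegrable (fun z => (z / (z - w)) * (u z : ℂ)) 0 1 :=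
    huc.continuousOn_mul (ContinuousOn.div (by fun_prop) (by fun_prop) hzw)
  have hi2 : CircleIntegrable (fun z => (2 : ℂ) • ((z / (z - w)) * (u z : ℂ))) 0 1 :=
    hi.const_smul
  rw [← hcauchy, ← smul_eq_mul, ← Real.circleAverage_fun_smul, neg_add_eq_sub,
    ← Real.circleAverage_fun_sub hi2 huc, schwarzIntegral]
  refine Real.circleAverage_congr_sphere fun z hz => ?_
  have := hzw z hz
  simp only [herglotzRieszKernel_def, sub_zero, smul_eq_mul]
  field_simp
  ring

/-- The coefficients come from the expansion of the Cauchy integral of `u`, from which the Schwarz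
integral is obtained by doubling and subtracting a constant. -/
theorem iteratedDeriv_schwarzIntegral_div_factorial {u : ℂ → ℝ} (hu : CircleIntegrable u 0 1)
    {j : ℕ} (hj : 1 ≤ j) : iteratedDeriv j (schwarzIntegral u) 0 / j.factorial =
      2 * Real.circleAverage (fun z => u z * z⁻¹ ^ j) 0 1 := by
  have hps := hasFPowerSeriesOn_cauchy_integral (R := 1) (circleIntegrable_ofReal hu) one_pos
  have hev : schwarzIntegral u =ᶠ[𝓝 0] fun w =>
      -Real.circleAverage (fun z => (u z : ℂ)) 0 1 +
        2 * ((2 * Real.pi * I : ℂ)⁻¹ • ∮ z in C(0, 1), (z - w)⁻¹ • (u z : ℂ)) := by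
    filter_upwards [isOpen_ball.mem_nhds (mem_ball_self (α := ℂ) one_pos)] with w hw
    exact schwarzIntegral_eq_circleIntegral hu hw
  have hcoeff : iteratedDeriv j
      (fun w => (2 * Real.pi * I : ℂ)⁻¹ • ∮ z in C(0, 1), (z - w)⁻¹ • (u z : ℂ)) 0 =
      j.factorial * Real.circleAverage (fun z => u z * z⁻¹ ^ j) 0 1 := by
    have h := hps.factorial_smul 1 j
    rw [cauchyPowerSeries_apply, nsmul_eq_mul] at h
    rw [iteratedDeriv_eq_iteratedFDeriv, Real.circleAverage_eq_circleIntegral one_ne_zero]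
    refine h.symm.trans ?_
    congr 2
    refine circleIntegral.integral_congr zero_le_one fun z hz => ?_
    simp only [sub_zero, smul_eq_mul]
    ring
  have hfac : (j.factorial : ℂ) ≠ 0 := Nat.cast_ne_zero.2 (Nat.factorial_ne_zero _)
  rw [hev.iteratedDeriv_eq, iteratedDeriv_const_add (by omega), iteratedDeriv_const_mul_field,
    hcoeff]
  field_simp

/-- The supremum in `K` is attained for the density that is the sign of the extremal kernel. -/
theorem exists_extremal (n : ℕ) : ∃ g : ℂ → ℂ, g ∈ realPartClass (ball 0 1) ∧
    2 ^ (n + 1) * K (n + 1) ≤ ‖iteratedDeriv (n + 1) (fun w => (1 + 1 * w) ^ n * g w) 0‖ := by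
  obtain ⟨α, hα⟩ := (isGreatest_cosIntegral (n + 1)).1
  set q : ℂ → ℂ := fun z => (1 + 1 * z) ^ n * z⁻¹ ^ (n + 1) with hq
  set k : ℂ → ℝ := fun z => (exp (-α * I) * q z).re with hk
  set u : ℂ → ℝ := fun z => if 0 ≤ k z then 1 else -1 with hu
  have huk (z : ℂ) : u z * k z = |k z| := by
    by_cases h : 0 ≤ k z
    · simp [hu, h, abs_of_nonneg h]
    · simp [hu, h, abs_of_neg (not_le.1 h)]
  have hu1 (z : ℂ) : |u z| ≤ 1 := by
    by_cases h : 0 ≤ k z <;> simp [hu, h]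
  have hui : CircleIntegrable u 0 1 := by
    have hkm : Measurable k := by fun_prop
    have hum : Measurable u :=
      Measurable.ite (measurableSet_le measurable_const hkm) measurable_const measurable_const
    refine (intervalIntegrable_const (c := (1 : ℝ))).mono_fun
      (hum.comp (continuous_circleMap 0 1).measurable).aestronglyMeasurable ?_
    exact Filter.Eventually.of_forall fun θ => by simpa using hu1 _
  have hqc : ContinuousOn q (sphere 0 |1|) :=
    ContinuousOn.mul (by fun_prop) ((continuousOn_inv₀.mono fun z hz =>
      ne_of_mem_sphere hz (abs_pos.2 one_ne_zero).ne').pow _)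
  refine ⟨schwarzIntegral u, ⟨differentiableOn_schwarzIntegral hui,
    fun w hw => abs_re_schwarzIntegral_le hui hu1 hw⟩, ?_⟩
  rw [iteratedDeriv_affine_pow_mul_eq_circleAverage isOpen_ball
    (differentiableOn_schwarzIntegral hui) (mem_ball_self one_pos) one_pos
    (circleIntegrable_ofReal hui)
    (fun j hj => iteratedDeriv_schwarzIntegral_div_factorial hui hj) n 1]
  have hval : 2 ^ n / Real.pi * (⨆ α : ℝ, cosIntegral (n + 1) α) ≤
      ‖Real.circleAverage (fun z => u z * q z) 0 1‖ := by
    rw [← hα, ← circleAverage_abs_re_kernel]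
    have h := re_mul_circleAverage ((circleIntegrable_ofReal hui).mul_continuousOn hqc)
      (exp (-α * I))
    have e : (fun z => u z * (exp (-α * I) * q z).re) =
        fun z => |(exp (-α * I) * ((1 + z) ^ n * z⁻¹ ^ (n + 1))).re| := by
      ext1 z
      simpa only [hk, hq, one_mul] using huk z
    rw [e] at h
    rw [← h]
    refine (re_le_norm _).trans_eq ?_
    rw [norm_mul, show -(α : ℂ) * I = ((-α : ℝ) : ℂ) * I by push_cast; ring,
      norm_exp_ofReal_mul_I, one_mul]
  rw [norm_mul, norm_mul, Complex.norm_natCast, RCLike.norm_ofNat]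
  refine le_trans (le_of_eq ?_)
    (mul_le_mul_of_nonneg_left (mul_le_mul_of_nonneg_left hval zero_le_two) (Nat.cast_nonneg _))
  rw [K]
  ring

/-! ### Sharpness in the unit disk -/

theorem touchedByDisk_unit : TouchedByDisk (ball 0 1) 1 0 1 where
  isOpen := isOpen_ball
  isConnected := (convex_ball 0 1).isConnected (nonempty_ball.2 one_pos)
  mem_frontier := by rw [frontier_ball 0 one_ne_zero]; simp
  radius_pos := one_pos
  disk_subset := subset_rfl
  mem_circle := by simp

/-- Bol's lemma for the composition of `g` with the automorphism that moves `r` to the center. -/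
theorem iteratedDeriv_comp_mobius_neg {g : ℂ → ℂ} (hg : DifferentiableOn ℂ g (ball 0 1)) {r : ℝ}
    (hr : |r| < 1) (n : ℕ) :
    iteratedDeriv (n + 1) (fun w => (1 + r * w) ^ n * g w) 0 =
      (1 - (r : ℂ) ^ 2) ^ (n + 1) * iteratedDeriv (n + 1) (fun z => g (mobius (-r) z)) r := by
  have hr' : |(-r)| < 1 := by rwa [abs_neg]
  have h0 : (0 : ℂ) ∈ ball (0 : ℂ) 1 := mem_ball_self one_pos
  have hbol := iteratedDeriv_affine_pow_mul_comp isOpen_ball isOpen_ball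
    (differentiableOn_comp_mobius hg hr')
    (fun w hw => one_add_mul_ne_zero hr hw) (fun w hw => hasDerivAt_mobius hr hw)
    (fun w hw => mobius_mem_ball hr hw) n h0
  have heq : Set.EqOn (fun w => (1 + r * w) ^ n * g w)
      (fun w => (1 + r * w) ^ n * g (mobius (-r) (mobius r w))) (ball 0 1) := fun w hw => by
    simp only [mobius_neg_mobius hr hw]
  rw [heq.iteratedDeriv_of_isOpen isOpen_ball (n + 1) h0, hbol, mobius_zero]
  simp

theorem K_le_radialLimsup_unit (n : ℕ) :
    ENNReal.ofReal (K (n + 1)) ≤ radialLimsup (n + 1) (ball 0 1) 1 0 := by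
  obtain ⟨g, hg, hK⟩ := exists_extremal n
  set T : ℝ → ℝ := fun r => ‖iteratedDeriv (n + 1) (fun w => (1 + (r : ℂ) * w) ^ n * g w) 0‖
    with hT
  have hTc : Continuous T := by
    simp only [hT, iteratedDeriv_affine_pow_mul_zero isOpen_ball hg.1 (mem_ball_self one_pos)]
    fun_prop
  have hT1 : 2 ^ (n + 1) * K (n + 1) ≤ T 1 := by simpa [hT] using hK
  set b : ℝ → ℝ := fun r => T r / (1 + r) ^ (n + 1) with hb
  have hb1 : K (n + 1) ≤ b 1 := by
    rw [hb, le_div_iff₀ (by norm_num)]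
    refine le_trans (le_of_eq ?_) hT1
    norm_num
    ring
  have hbc : ContinuousAt b 1 :=
    hTc.continuousAt.div (by fun_prop) (by norm_num)
  have hne : (𝓝[openSegment ℝ (0 : ℂ) 1] 1).NeBot := by
    rw [← mem_closure_iff_nhdsWithin_neBot, closure_openSegment]
    exact right_mem_segment ℝ _ _
  have hlim : Filter.Tendsto (fun z : ℂ => ENNReal.ofReal (b z.re))
      (𝓝[openSegment ℝ (0 : ℂ) 1] 1) (𝓝 (ENNReal.ofReal (b 1))) := by
    refine ENNReal.tendsto_ofReal (hbc.tendsto.comp ?_)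
    exact (continuous_re.tendsto' 1 1 one_re).mono_left nhdsWithin_le_nhds
  refine (ENNReal.ofReal_le_ofReal hb1).trans ?_
  rw [radialLimsup, ← hlim.limsup_eq]
  refine Filter.limsup_le_limsup ?_
  filter_upwards [self_mem_nhdsWithin] with z hz
  rw [openSegment_eq_image'] at hz
  obtain ⟨r, ⟨hr0, hr1⟩, rfl⟩ := hz
  have hr : |r| < 1 := by rwa [abs_of_pos hr0]
  have hr' : |(-r)| < 1 := by rwa [abs_neg]
  have hz' : (0 : ℂ) + r • (1 - 0) = r := by simp
  have hmem : (fun z => g (mobius (-r) z)) ∈ realPartClass (ball 0 1) :=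
    ⟨differentiableOn_comp_mobius hg.1 hr', fun z hz => hg.2 _ (mobius_mem_ball hr' hz)⟩
  refine le_trans (ENNReal.ofReal_le_ofReal ?_)
    (le_iSup₂ (f := fun f (_ : f ∈ realPartClass (ball 0 1)) => ENNReal.ofReal
      (‖(0 : ℂ) + r • (1 - 0) - 1‖ ^ (n + 1) *
        ‖iteratedDeriv (n + 1) f ((0 : ℂ) + r • (1 - 0))‖)) _ hmem)
  have hd : ‖(r : ℂ) - 1‖ = 1 - r := by
    rw [show (r : ℂ) - 1 = ((r - 1 : ℝ) : ℂ) by push_cast; rfl, norm_real, Real.norm_eq_abs,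
      abs_sub_comm, abs_of_pos (by linarith)]
  simp only [hz', ofReal_re, hd, hb, hT]
  rw [iteratedDeriv_comp_mobius_neg hg.1 hr, norm_mul, norm_pow, norm_one_sub_ofReal_sq hr, mul_pow]
  have : (1 + r) ^ (n + 1) ≠ 0 := by positivity
  refine le_of_eq ?_
  field_simp

end RealPart

theorem theorem4 (s : ℕ) (hs : 1 ≤ s) :
    -- the estimate, for all domains, boundary points and touching interior disks
    (∀ (Ω : Set ℂ) (ζ c : ℂ) (R : ℝ), RealPart.TouchedByDisk Ω ζ c R →
      RealPart.radialLimsup s Ω ζ c ≤ ENNReal.ofReal (RealPart.K s)) ∧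
    -- the constant cannot be diminished
    (∀ C : ℝ, C < RealPart.K s →
      ∃ (Ω : Set ℂ) (ζ c : ℂ) (R : ℝ), RealPart.TouchedByDisk Ω ζ c R ∧
        ENNReal.ofReal C < RealPart.radialLimsup s Ω ζ c) := by
  obtain ⟨n, rfl⟩ := Nat.exists_eq_add_of_le' hs
  refine ⟨fun Ω ζ c R h => RealPart.radialLimsup_le h n, fun C hC =>
    ⟨Metric.ball 0 1, 1, 0, 1, RealPart.touchedByDisk_unit, ?_⟩⟩
  exact ((ENNReal.ofReal_lt_ofReal_iff (RealPart.K_pos n)).2 hC).trans_le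
    (RealPart.K_le_radialLimsup_unit n)
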